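/- A function $f:X\to Y$ between topological spaces (not necessarily continuous) is *weakly discontinuous* if every subset $A\subseteq X$ contains a relatively open dense subset $U\subseteq A$ such that $f|_U$ is continuous. Spaces $X,Y$ are *weakly homeomorphic* if there is a bijection $f:X\to Y$ such that both $f$ and $f^{-1}$ are weakly discontinuous. A space is *perfectly paracompact* if it is paracompact (Hausdorff included) and each of its open subsets is an $F_\sigma$-set. For a space $X$, the network weight $nw(X)$ is the smallest size of a family $\mathcal N$ of subsets of $X$ such that for every $x\in X$ and every neighborhood $U$ of $x$ there is $N\in\mathcal N$ with $x\in N\subseteq U$; the hereditary Lindelöf number $hl(X)$ is the smallest cardinal $\kappa$ such that each open cover of each subspace of $X$ has a subcover of cardinality $\le\kappa$; the hereditary density $hd(X)$ is the smallest cardinal $\kappa$ such that each subspace of $X$ has a dense subset of cardinality $\le\kappa$. The covering dimension $\dim X$ is $-1$ if $X=\emptyset$; otherwise it is the least integer $n\ge 0$ such that every finite open cover of $X$ has a finite open refinement in which every point lies in at most $n+1$ members, and $\infty$ if there is no such $n$. A space is *analytic* if it is a continuous image of a Polish (separable completely metrizable) space, *$\sigma$-compact* if it is a countable union of compact subsets,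 and *$\sigma$-Polish* if it is a countable union of closed Polish subspaces. **Corollary.** If $X,Y$ are weakly homeomorphic perfectly paracompact spaces, then 1. $nw(X)=nw(Y)$; 2. $hl(X)=hl(Y)$; 3. $hd(X)=hd(Y)$; 4. $\dim X=\dim Y$; 5. $X$ is analytic if and only if $Y$ is analytic; 6. $X$ is $\sigma$-compact if and only if $Y$ is $\sigma$-compact; 7. $X$ is $\sigma$-Polish if and only if $Y$ is $\sigma$-Polish. -/

import Mathlib

open Set
open scoped Topology Cardinal

universe u v

/-- `f` is weakly discontinuous: every subset `A` of `X` contains a relatively open, dense subset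
`U` of `A` such that the restriction of `f` to `U` is continuous. -/
def IsWeaklyDiscontinuous {X : Type u} {Y : Type v} [TopologicalSpace X] [TopologicalSpace Y]
    (f : X → Y) : Prop :=
  ∀ A : Set X, ∃ U ⊆ A, (∃ O : Set X, IsOpen O ∧ U = A ∩ O) ∧ A ⊆ closure U ∧ ContinuousOn f U

/-- There is a bijection `X → Y` that is weakly discontinuous together with its inverse. -/
def WeaklyHomeomorphic (X : Type u) (Y : Type v) [TopologicalSpace X] [TopologicalSpace Y] :
    Prop :=
  ∃ f : X ≃ Y, IsWeaklyDiscontinuous f ∧ IsWeaklyDiscontinuous f.symm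

/-- Perfectly paracompact spaces: paracompact (the Hausdorff axiom is included, as usual) and every
open set is a countable union of closed sets. -/
structure PerfectlyParacompact (X : Type u) [TopologicalSpace X] : Prop where
  t2 : T2Space X
  paracompact : ParacompactSpace X
  open_fsigma : ∀ U : Set X, IsOpen U → ∃ F : ℕ → Set X, (∀ n, IsClosed (F n)) ∧ U = ⋃ n, F n

/-- A family `N` of subsets of `X` is a network. -/
def IsNetwork {X : Type u} [TopologicalSpace X] (N : Set (Set X)) : Prop :=
  ∀ x : X, ∀ U ∈ 𝓝 x, ∃ S ∈ N, x ∈ S ∧ S ⊆ U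

/-- The network weight: the smallest size of a network. -/
noncomputable def networkWeight (X : Type u) [TopologicalSpace X] : Cardinal.{u} :=
  sInf {κ | ∃ N : Set (Set X), IsNetwork N ∧ #N = κ}

/-- The hereditary Lindelöf number: the smallest `κ` such that every cover of a subspace `Z` by
open sets has a subcover of size at most `κ`. -/
noncomputable def hereditaryLindelofNumber (X : Type u) [TopologicalSpace X] : Cardinal.{u} :=
  sInf {κ | ∀ (Z : Set X) (C : Set (Set X)), (∀ U ∈ C, IsOpen U) → Z ⊆ ⋃₀ C →
    ∃ C' ⊆ C, #C' ≤ κ ∧ Z ⊆ ⋃₀ C'}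

/-- The hereditary density: the smallest `κ` such that every subspace `Z` has a dense subset of size
at most `κ`. -/
noncomputable def hereditaryDensity (X : Type u) [TopologicalSpace X] : Cardinal.{u} :=
  sInf {κ | ∀ Z : Set X, ∃ D ⊆ Z, #D ≤ κ ∧ Z ⊆ closure D}

/-- Every finite open cover of `X` has a finite open refinement of order at most `n`, i.e. one such
that every point lies in at most `n + 1` of its members. -/
def CoveringDimLE (X : Type u) [TopologicalSpace X] (n : ℕ) : Prop :=
  ∀ C : Set (Set X), C.Finite → (∀ U ∈ C, IsOpen U) → ⋃₀ C = univ →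
    ∃ R : Set (Set X), R.Finite ∧ (∀ V ∈ R, IsOpen V) ∧ ⋃₀ R = univ ∧
      (∀ V ∈ R, ∃ U ∈ C, V ⊆ U) ∧ ∀ x : X, {V ∈ R | x ∈ V}.encard ≤ n + 1

/-- The covering dimension. The value `⊥` plays the role of `-1`, the dimension of the empty
space, and `⊤` is infinite dimension. -/
noncomputable def coveringDim (X : Type u) [TopologicalSpace X] : WithBot ℕ∞ :=
  sInf {d | (d = ⊥ ∧ IsEmpty X) ∨ ∃ n : ℕ, d = ((n : ℕ∞) : WithBot ℕ∞) ∧ CoveringDimLE X n}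

/-- `X` is a continuous image of a Polish space. Every Polish space has at most continuum many
points, so letting `P` range over `Type` is no restriction. -/
def IsAnalyticSpace (X : Type u) [TopologicalSpace X] : Prop :=
  ∃ (P : Type) (_ : TopologicalSpace P) (_ : PolishSpace P) (g : P → X),
    Continuous g ∧ Function.Surjective g

/-- `X` is a countable union of closed Polish subspaces. -/
def IsSigmaPolish (X : Type u) [TopologicalSpace X] : Prop :=
  ∃ F : ℕ → Set X, (∀ n, IsClosed (F n)) ∧ (∀ n, PolishSpace (F n)) ∧ ⋃ n, F n = univ

/-! ### Closed decompositions of weakly discontinuous maps -/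

/-- `W` is a countable union of closed sets on each of which `f` is continuous. -/
def IsSigmaContinuousOn {X : Type u} {Y : Type v} [TopologicalSpace X] [TopologicalSpace Y]
    (f : X → Y) (W : Set X) : Prop :=
  ∃ F : ℕ → Set X, (∀ n, IsClosed (F n)) ∧ (∀ n, ContinuousOn f (F n)) ∧ W = ⋃ n, F n

section SigmaContinuous

variable {X : Type u} {Y : Type v} [TopologicalSpace X] [TopologicalSpace Y] {f : X → Y}

theorem IsSigmaContinuousOn.of_countable {ι : Type*} [Countable ι] {W : Set X} {F : ι → Set X}
    (hc : ∀ n, IsClosed (F n)) (hf : ∀ n, ContinuousOn f (F n)) (hW : W = ⋃ n, F n) :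
    IsSigmaContinuousOn f W := by
  rcases isEmpty_or_nonempty ι with h | h
  · refine ⟨fun _ => ∅, fun _ => isClosed_empty, fun _ => continuousOn_empty f, ?_⟩
    simp [hW]
  · obtain ⟨e, he⟩ := exists_surjective_nat ι
    exact ⟨F ∘ e, fun n => hc _, fun n => hf _, by rw [hW]; exact (he.iUnion_comp F).symm⟩

theorem IsSigmaContinuousOn.union {V W : Set X} (hV : IsSigmaContinuousOn f V)
    (hW : IsSigmaContinuousOn f W) : IsSigmaContinuousOn f (V ∪ W) := by
  obtain ⟨F, hFc, hFf, rfl⟩ := hV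
  obtain ⟨G, hGc, hGf, rfl⟩ := hW
  refine .of_countable (F := Sum.elim F G) ?_ ?_ ?_
  · rintro (n | n)
    exacts [hFc n, hGc n]
  · rintro (n | n)
    exacts [hFf n, hGf n]
  · simp [iUnion_sumElim]

/-- In a perfectly paracompact space, a union of open sets on which `f` is σ-continuous is again
such a set. -/
theorem PerfectlyParacompact.isSigmaContinuousOn_sUnion (hX : PerfectlyParacompact X)
    {C : Set (Set X)} (ho : ∀ V ∈ C, IsOpen V) (hC : ∀ V ∈ C, IsSigmaContinuousOn f V) :
    IsSigmaContinuousOn f (⋃₀ C) := by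
  have := hX.t2
  have := hX.paracompact
  obtain ⟨F, hFc, hF⟩ := hX.open_fsigma _ (isOpen_sUnion ho)
  choose K hKc hKf hK using fun V : C => hC V V.2
  have key : ∀ n, ∃ v : C → Set X, F n ⊆ iUnion v ∧ LocallyFinite v ∧
      (∀ V, IsClosed (v V)) ∧ ∀ V, v V ⊆ V := by
    intro n
    have hcov : F n ⊆ ⋃ V : C, (V : Set X) := by
      rw [← sUnion_eq_iUnion, hF]
      exact subset_iUnion F n
    obtain ⟨w, hwo, hwF, hwl, hwV⟩ :=
      precise_refinement_set (hFc n) (fun V : C => (V : Set X)) (fun V => ho V V.2) hcov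
    obtain ⟨v, hvF, hvc, hvw⟩ :=
      exists_subset_iUnion_closed_subset (hFc n) hwo (fun x _ => hwl.point_finite x) hwF
    exact ⟨v, hvF, hwl.subset hvw, hvc, fun V => (hvw V).trans (hwV V)⟩
  choose v hvF hvl hvc hvV using key
  have hlf : ∀ p : ℕ × ℕ, LocallyFinite fun V : C => v p.1 V ∩ K V p.2 := fun p =>
    (hvl p.1).subset fun V => inter_subset_left
  have hcl : ∀ (p : ℕ × ℕ) (V : C), IsClosed (v p.1 V ∩ K V p.2) := fun p V =>
    (hvc p.1 V).inter (hKc V p.2)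
  refine .of_countable (F := fun p : ℕ × ℕ => ⋃ V : C, v p.1 V ∩ K V p.2)
    (fun p => (hlf p).isClosed_iUnion (hcl p))
    (fun p => (hlf p).continuousOn_iUnion (hcl p) fun V => (hKf V p.2).mono inter_subset_right) ?_
  apply Subset.antisymm
  · rw [hF]
    refine iUnion_subset fun n x hx => ?_
    obtain ⟨V, hV⟩ := mem_iUnion.1 (hvF n hx)
    have hxV : x ∈ (V : Set X) := hvV n V hV
    rw [hK V] at hxV
    obtain ⟨k, hk⟩ := mem_iUnion.1 hxV
    exact mem_iUnion.2 ⟨(n, k), mem_iUnion.2 ⟨V, hV, hk⟩⟩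
  · exact iUnion_subset fun p => iUnion_subset fun V x hx => ⟨V, V.2, hvV p.1 V hx.1⟩

/-- A weakly discontinuous map on a perfectly paracompact space is continuous on each member of a
countable closed cover. -/
theorem IsWeaklyDiscontinuous.isSigmaContinuousOn_univ (hX : PerfectlyParacompact X)
    (hf : IsWeaklyDiscontinuous f) : IsSigmaContinuousOn f univ := by
  let C : Set (Set X) := {V | IsOpen V ∧ IsSigmaContinuousOn f V}
  have hWo : IsOpen (⋃₀ C) := isOpen_sUnion fun V hV => hV.1
  have hW : IsSigmaContinuousOn f (⋃₀ C) :=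
    hX.isSigmaContinuousOn_sUnion (fun V hV => hV.1) fun V hV => hV.2
  obtain ⟨U, hUA, ⟨O, hO, hUO⟩, hd, hfU⟩ := hf (⋃₀ C)ᶜ
  have hU : IsSigmaContinuousOn f U := by
    obtain ⟨F, hFc, hF⟩ := hX.open_fsigma O hO
    have hUF : U = ⋃ n, (⋃₀ C)ᶜ ∩ F n := by rw [hUO, hF, inter_iUnion]
    refine ⟨_, fun n => hWo.isClosed_compl.inter (hFc n), fun n => hfU.mono ?_, hUF⟩
    rw [hUF]
    exact subset_iUnion (fun n => (⋃₀ C)ᶜ ∩ F n) n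
  have hunion : ⋃₀ C ∪ U = ⋃₀ C ∪ O := by
    rw [hUO]
    ext x
    by_cases hx : x ∈ ⋃₀ C <;> simp only [mem_union, mem_inter_iff, mem_compl_iff, hx] <;> tauto
  have hmem : ⋃₀ C ∪ U ∈ C := ⟨by rw [hunion]; exact hWo.union hO, hW.union hU⟩
  have hU0 : U = ∅ := eq_empty_of_forall_notMem fun x hx =>
    hUA hx (subset_sUnion_of_mem hmem (Or.inr hx))
  have hcompl : (⋃₀ C)ᶜ = ∅ := by
    rw [hU0, closure_empty] at hd
    exact subset_empty_iff.1 hd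
  rwa [← compl_empty_iff.1 hcompl]

end SigmaContinuous

/-! ### Bijections that are homeomorphisms on the members of a closed cover -/

/-- The sets `A i` form a closed cover of `X`, their images form a closed cover of `Y`, and `f`
restricts to homeomorphisms between corresponding members. -/
structure PiecewiseHomeo {X : Type u} {Y : Type v} [TopologicalSpace X] [TopologicalSpace Y]
    {ι : Type} (f : X ≃ Y) (A : ι → Set X) : Prop where
  isClosed : ∀ i, IsClosed (A i)
  isClosed_image : ∀ i, IsClosed (f '' A i)
  cover : ⋃ i, A i = univ
  continuousOn : ∀ i, ContinuousOn f (A i)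
  continuousOn_symm : ∀ i, ContinuousOn f.symm (f '' A i)

theorem WeaklyHomeomorphic.exists_piecewiseHomeo {X : Type u} {Y : Type v} [TopologicalSpace X]
    [TopologicalSpace Y] (hX : PerfectlyParacompact X) (hY : PerfectlyParacompact Y)
    (h : WeaklyHomeomorphic X Y) :
    ∃ (f : X ≃ Y) (A : ℕ × ℕ → Set X), PiecewiseHomeo f A := by
  obtain ⟨f, hf, hg⟩ := h
  obtain ⟨F, hFc, hFf, hF⟩ := hf.isSigmaContinuousOn_univ hX
  obtain ⟨G, hGc, hGf, hG⟩ := hg.isSigmaContinuousOn_univ hY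
  have him : ∀ p : ℕ × ℕ, f '' (F p.1 ∩ f ⁻¹' G p.2) = G p.2 ∩ f.symm ⁻¹' F p.1 := by
    intro p
    rw [image_inter_preimage, f.image_eq_preimage_symm, inter_comm]
  refine ⟨f, fun p => F p.1 ∩ f ⁻¹' G p.2,
    fun p => (hFf p.1).preimage_isClosed_of_isClosed (hFc p.1) (hGc p.2), fun p => ?_, ?_,
    fun p => (hFf p.1).mono inter_subset_left, fun p => ?_⟩
  · rw [him]
    exact (hGf p.2).preimage_isClosed_of_isClosed (hGc p.2) (hFc p.1)
  · refine eq_univ_of_forall fun x => ?_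
    obtain ⟨n, hn⟩ := mem_iUnion.1 (hF ▸ mem_univ x)
    obtain ⟨m, hm⟩ := mem_iUnion.1 (hG ▸ mem_univ (f x))
    exact mem_iUnion.2 ⟨(n, m), hn, hm⟩
  · rw [him]
    exact (hGf p.2).mono inter_subset_left

namespace PiecewiseHomeo

variable {X : Type u} {Y : Type v} [TopologicalSpace X] [TopologicalSpace Y] {ι : Type}
  {f : X ≃ Y} {A : ι → Set X}

theorem of_finite [T1Space X] [T1Space Y] [Finite Y] (f : X ≃ Y) :
    PiecewiseHomeo f fun _ : Unit => (univ : Set X) := by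
  have : Finite X := Finite.of_equiv Y f.symm
  exact ⟨fun _ => isClosed_discrete _, fun _ => isClosed_discrete _, iUnion_const _,
    fun _ => continuous_of_discreteTopology.continuousOn,
    fun _ => continuous_of_discreteTopology.continuousOn⟩

theorem symm (h : PiecewiseHomeo f A) : PiecewiseHomeo f.symm fun i => f '' A i where
  isClosed := h.isClosed_image
  isClosed_image i := by simpa using h.isClosed i
  cover := by rw [← image_iUnion, h.cover, image_univ, f.range_eq_univ]
  continuousOn := h.continuousOn_symm
  continuousOn_symm i := by simpa using h.continuousOn i

theorem exists_mem (h : PiecewiseHomeo f A) (x : X) : ∃ i, x ∈ A i :=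
  mem_iUnion.1 (h.cover ▸ mem_univ x)

theorem exists_isOpen_source (h : PiecewiseHomeo f A) (i : ι) {O : Set Y} (hO : IsOpen O) :
    ∃ V : Set X, IsOpen V ∧ ∀ x ∈ A i, x ∈ V ↔ f x ∈ O := by
  obtain ⟨V, hV, hVO⟩ := continuousOn_iff'.1 (h.continuousOn i) O hO
  refine ⟨V, hV, fun x hx => ?_⟩
  have := Set.ext_iff.1 hVO x
  simp only [mem_inter_iff, mem_preimage, hx, and_true] at this
  exact this.symm

theorem exists_isOpen_target (h : PiecewiseHomeo f A) (i : ι) {O : Set X} (hO : IsOpen O) :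
    ∃ V : Set Y, IsOpen V ∧ ∀ x ∈ A i, f x ∈ V ↔ x ∈ O := by
  obtain ⟨V, hV, hVO⟩ := h.symm.exists_isOpen_source i hO
  exact ⟨V, hV, fun x hx => by simpa using hVO (f x) (mem_image_of_mem f hx)⟩

/-! ### Cardinal invariants -/

/-- To compare cardinals it suffices to compare them up to the number of pieces, if the larger one
is infinite for infinite spaces. -/
theorem le_of_forall_le_mk_mul [T1Space X] [T1Space Y] [Countable ι] (h : PiecewiseHomeo f A)
    {a b : Cardinal.{max u v}} (hb : Infinite Y → ℵ₀ ≤ b)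
    (hab : ∀ {ι : Type} {A : ι → Set X}, PiecewiseHomeo f A →
      a ≤ Cardinal.lift.{max u v} #ι * b) : a ≤ b := by
  cases finite_or_infinite Y with
  | inl hfin => simpa using hab (of_finite f)
  | inr hinf =>
    calc a ≤ Cardinal.lift.{max u v} #ι * b := hab h
      _ ≤ ℵ₀ * b := by
        gcongr
        exact Cardinal.lift_le_aleph0.2 (Cardinal.mk_le_aleph0)
      _ = b := Cardinal.aleph0_mul_eq (hb hinf)

theorem mk_iUnion_image_le {α : Type u} {β : Type v} (g : ι → β → α) (S : ι → Set β)
    {κ : Cardinal.{v}} (hS : ∀ i, #(S i) ≤ κ) :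
    Cardinal.lift.{v} #(⋃ i, g i '' S i : Set α) ≤
      Cardinal.lift.{max u v} #ι * Cardinal.lift.{u} κ := by
  have hrange : (⋃ i, g i '' S i : Set α) = range fun p : Σ i, S i => g p.1 p.2 := by
    ext x
    simp [Sigma.exists]
  calc Cardinal.lift.{v} #(⋃ i, g i '' S i : Set α)
      ≤ Cardinal.lift.{u} #(Σ i, S i) := by
        rw [hrange]
        exact Cardinal.mk_range_le_lift
    _ = Cardinal.lift.{u} (Cardinal.sum fun i => #(S i)) := by rw [Cardinal.mk_sigma]
    _ ≤ Cardinal.lift.{u} (Cardinal.sum fun _ : ι => κ) :=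
        Cardinal.lift_le.2 (Cardinal.sum_le_sum _ _ hS)
    _ = Cardinal.lift.{max u v} #ι * Cardinal.lift.{u} κ := by simp [Cardinal.sum_const]

end PiecewiseHomeo

section Attained

variable (X : Type u) [TopologicalSpace X]

theorem exists_isNetwork_mk_eq_networkWeight :
    ∃ N : Set (Set X), IsNetwork N ∧ #N = networkWeight X :=
  csInf_mem (s := {κ | ∃ N : Set (Set X), IsNetwork N ∧ #N = κ})
    ⟨_, univ, fun _ U hU => ⟨U, mem_univ U, mem_of_mem_nhds hU, Subset.rfl⟩, rfl⟩

theorem mk_set_mem_hereditaryLindelof :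
    #(Set X) ∈ {κ : Cardinal.{u} | ∀ (Z : Set X) (C : Set (Set X)), (∀ U ∈ C, IsOpen U) →
      Z ⊆ ⋃₀ C → ∃ C' ⊆ C, #C' ≤ κ ∧ Z ⊆ ⋃₀ C'} :=
  fun _ C _ hZ => ⟨C, Subset.rfl, Cardinal.mk_set_le C, hZ⟩

theorem hereditaryLindelofNumber_le_mk_set : hereditaryLindelofNumber X ≤ #(Set X) :=
  csInf_le' (mk_set_mem_hereditaryLindelof X)

variable {X} in
theorem exists_subcover_mk_le_hereditaryLindelofNumber (Z : Set X) (C : Set (Set X))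
    (hC : ∀ U ∈ C, IsOpen U) (hZ : Z ⊆ ⋃₀ C) :
    ∃ C' ⊆ C, #C' ≤ hereditaryLindelofNumber X ∧ Z ⊆ ⋃₀ C' :=
  csInf_mem ⟨_, mk_set_mem_hereditaryLindelof X⟩ Z C hC hZ

theorem mk_mem_hereditaryDensity :
    #X ∈ {κ : Cardinal.{u} | ∀ Z : Set X, ∃ D ⊆ Z, #D ≤ κ ∧ Z ⊆ closure D} :=
  fun Z => ⟨Z, Subset.rfl, Cardinal.mk_set_le Z, subset_closure⟩

theorem hereditaryDensity_le_mk : hereditaryDensity X ≤ #X :=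
  csInf_le' (mk_mem_hereditaryDensity X)

variable {X} in
theorem exists_dense_mk_le_hereditaryDensity (Z : Set X) :
    ∃ D ⊆ Z, #D ≤ hereditaryDensity X ∧ Z ⊆ closure D :=
  csInf_mem ⟨_, mk_mem_hereditaryDensity X⟩ Z

theorem aleph0_le_networkWeight [T1Space X] [Infinite X] : ℵ₀ ≤ networkWeight X := by
  obtain ⟨N, hN, hNκ⟩ := exists_isNetwork_mk_eq_networkWeight X
  rw [← hNκ, Cardinal.aleph0_le_mk_iff]
  by_contra hfin
  rw [not_infinite_iff_finite] at hfin
  refine not_finite_iff_infinite.2 ‹Infinite X›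
    (Finite.of_injective (fun x : X => {S : N | x ∈ (S : Set X)}) fun x y hxy => ?_)
  by_contra hne
  obtain ⟨S, hS, hxS, hSy⟩ := hN x {y}ᶜ (isOpen_compl_singleton.mem_nhds hne)
  have : y ∈ S := (Set.ext_iff.1 hxy ⟨S, hS⟩).1 hxS
  exact hSy this rfl

theorem aleph0_le_hereditaryLindelofNumber [T2Space X] [Infinite X] :
    ℵ₀ ≤ hereditaryLindelofNumber X := by
  obtain ⟨U, hUi, hUo, hUd⟩ := exists_seq_infinite_isOpen_pairwise_disjoint X
  obtain ⟨C, hCU, hCκ, hC⟩ := exists_subcover_mk_le_hereditaryLindelofNumber (⋃ n, U n) (range U)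
    (forall_mem_range.2 hUo) (by rw [sUnion_range])
  have hmem : ∀ n, U n ∈ C := by
    intro n
    obtain ⟨x, hx⟩ := (hUi n).nonempty
    obtain ⟨V, hV, hxV⟩ := hC (mem_iUnion.2 ⟨n, hx⟩)
    obtain ⟨m, rfl⟩ := hCU hV
    rwa [hUd.eq (not_disjoint_iff.2 ⟨x, hx, hxV⟩)]
  refine le_trans ?_ hCκ
  rw [Cardinal.aleph0_le_mk_iff]
  refine Infinite.of_injective (fun n => (⟨U n, hmem n⟩ : C)) fun n m hnm => ?_
  obtain ⟨x, hx⟩ := (hUi n).nonempty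
  have hnm' : U n = U m := congrArg Subtype.val hnm
  exact hUd.eq (not_disjoint_iff.2 ⟨x, hx, hnm' ▸ hx⟩)

theorem aleph0_le_hereditaryDensity [T2Space X] [Infinite X] : ℵ₀ ≤ hereditaryDensity X := by
  obtain ⟨U, hUi, hUo, hUd⟩ := exists_seq_infinite_isOpen_pairwise_disjoint X
  obtain ⟨D, -, hDκ, hD⟩ := exists_dense_mk_le_hereditaryDensity (⋃ n, U n)
  have hmeet : ∀ n, (U n ∩ D).Nonempty := by
    intro n
    obtain ⟨x, hx⟩ := (hUi n).nonempty
    exact mem_closure_iff.1 (hD (mem_iUnion.2 ⟨n, hx⟩)) _ (hUo n) hx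
  choose d hdU hdD using hmeet
  refine le_trans ?_ hDκ
  rw [Cardinal.aleph0_le_mk_iff]
  refine Infinite.of_injective (fun n => (⟨d n, hdD n⟩ : D)) fun n m hnm => ?_
  have hnm' : d n = d m := congrArg Subtype.val hnm
  exact hUd.eq (not_disjoint_iff.2 ⟨d n, hdU n, hnm' ▸ hdU m⟩)

end Attained

namespace PiecewiseHomeo

variable {X : Type u} {Y : Type v} [TopologicalSpace X] [TopologicalSpace Y] {ι : Type}
  {f : X ≃ Y} {A : ι → Set X}

theorem lift_networkWeight_le_mul (h : PiecewiseHomeo f A) :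
    Cardinal.lift.{v} (networkWeight X) ≤
      Cardinal.lift.{max u v} #ι * Cardinal.lift.{u} (networkWeight Y) := by
  obtain ⟨N, hN, hNκ⟩ := exists_isNetwork_mk_eq_networkWeight Y
  refine le_trans (Cardinal.lift_le.2 (csInf_le' ⟨_, ?_, rfl⟩))
    (mk_iUnion_image_le (fun i S => A i ∩ f ⁻¹' S) (fun _ => N) fun _ => hNκ.le)
  intro x U hU
  obtain ⟨i, hi⟩ := h.exists_mem x
  obtain ⟨O, hOU, hO, hxO⟩ := mem_nhds_iff.1 hU
  obtain ⟨V, hV, hVO⟩ := h.exists_isOpen_target i hO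
  obtain ⟨S, hS, hxS, hSV⟩ := hN (f x) V (hV.mem_nhds ((hVO x hi).2 hxO))
  exact ⟨_, mem_iUnion.2 ⟨i, S, hS, rfl⟩, ⟨hi, hxS⟩,
    fun y hy => hOU ((hVO y hy.1).1 (hSV hy.2))⟩

theorem lift_networkWeight_le [T1Space X] [T1Space Y] [Countable ι] (h : PiecewiseHomeo f A) :
    Cardinal.lift.{v} (networkWeight X) ≤ Cardinal.lift.{u} (networkWeight Y) :=
  h.le_of_forall_le_mk_mul (fun _ => Cardinal.aleph0_le_lift.2 (aleph0_le_networkWeight Y))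
    lift_networkWeight_le_mul

theorem lift_hereditaryLindelofNumber_le_mul (h : PiecewiseHomeo f A) :
    Cardinal.lift.{v} (hereditaryLindelofNumber X) ≤
      Cardinal.lift.{max u v} #ι * Cardinal.lift.{u} (hereditaryLindelofNumber Y) := by
  have hκ : Cardinal.lift.{u} (hereditaryLindelofNumber Y) ≤ Cardinal.lift.{v} #(Set X) := by
    refine (Cardinal.lift_le.2 (hereditaryLindelofNumber_le_mk_set Y)).trans_eq ?_
    exact Cardinal.lift_mk_eq'.2 ⟨Equiv.Set.congr f.symm⟩
  obtain ⟨κ, hκ⟩ := Cardinal.mem_range_lift_of_le hκ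
  have hle : hereditaryLindelofNumber X ≤ Cardinal.lift.{u} #ι * κ := by
    refine csInf_le' fun Z C hCo hZ => ?_
    have hpiece : ∀ i, ∃ C' : Set (Set Y), (∀ V ∈ C', ∃ U ∈ C, ∀ x ∈ A i, f x ∈ V ↔ x ∈ U) ∧
        #C' ≤ hereditaryLindelofNumber Y ∧ f '' (Z ∩ A i) ⊆ ⋃₀ C' := by
      intro i
      obtain ⟨C', hC', hcard, hcov⟩ := exists_subcover_mk_le_hereditaryLindelofNumber
        (f '' (Z ∩ A i)) {V | IsOpen V ∧ ∃ U ∈ C, ∀ x ∈ A i, f x ∈ V ↔ x ∈ U}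
        (fun V hV => hV.1) (by
          rintro _ ⟨x, ⟨hxZ, hxA⟩, rfl⟩
          obtain ⟨U, hU, hxU⟩ := hZ hxZ
          obtain ⟨V, hV, hVU⟩ := h.exists_isOpen_target i (hCo U hU)
          exact ⟨V, ⟨hV, U, hU, hVU⟩, (hVU x hxA).2 hxU⟩)
      exact ⟨C', fun V hV => (hC' hV).2, hcard, hcov⟩
    choose C' hC' hcard hcov using hpiece
    classical
    let g : ι → Set Y → Set X := fun i V =>
      if hV : V ∈ C' i then (hC' i V hV).choose else ∅
    have hg : ∀ i V, V ∈ C' i → g i V ∈ C ∧ ∀ x ∈ A i, f x ∈ V ↔ x ∈ g i V := by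
      intro i V hV
      simp only [g, dif_pos hV]
      exact (hC' i V hV).choose_spec
    refine ⟨⋃ i, g i '' C' i, ?_, ?_, ?_⟩
    · refine iUnion_subset fun i => ?_
      rintro _ ⟨V, hV, rfl⟩
      exact (hg i V hV).1
    · rw [← Cardinal.lift_le.{v}, Cardinal.lift_mul, hκ, Cardinal.lift_lift]
      exact mk_iUnion_image_le g C' hcard
    · intro x hx
      obtain ⟨i, hi⟩ := h.exists_mem x
      obtain ⟨V, hV, hxV⟩ := hcov i (mem_image_of_mem f ⟨hx, hi⟩)
      exact ⟨g i V, mem_iUnion.2 ⟨i, V, hV, rfl⟩, ((hg i V hV).2 x hi).1 hxV⟩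
  have := Cardinal.lift_le.{v}.2 hle
  rwa [Cardinal.lift_mul, hκ, Cardinal.lift_lift] at this

theorem lift_hereditaryLindelofNumber_le [T2Space X] [T2Space Y] [Countable ι]
    (h : PiecewiseHomeo f A) : Cardinal.lift.{v} (hereditaryLindelofNumber X) ≤
      Cardinal.lift.{u} (hereditaryLindelofNumber Y) :=
  h.le_of_forall_le_mk_mul
    (fun _ => Cardinal.aleph0_le_lift.2 (aleph0_le_hereditaryLindelofNumber Y))
    lift_hereditaryLindelofNumber_le_mul

theorem lift_hereditaryDensity_le_mul (h : PiecewiseHomeo f A) :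
    Cardinal.lift.{v} (hereditaryDensity X) ≤
      Cardinal.lift.{max u v} #ι * Cardinal.lift.{u} (hereditaryDensity Y) := by
  have hκ : Cardinal.lift.{u} (hereditaryDensity Y) ≤ Cardinal.lift.{v} #X := by
    refine (Cardinal.lift_le.2 (hereditaryDensity_le_mk Y)).trans_eq ?_
    exact Cardinal.lift_mk_eq'.2 ⟨f.symm⟩
  obtain ⟨κ, hκ⟩ := Cardinal.mem_range_lift_of_le hκ
  have hle : hereditaryDensity X ≤ Cardinal.lift.{u} #ι * κ := by
    refine csInf_le' fun Z => ?_
    choose D hDZ hcard hD using fun i => exists_dense_mk_le_hereditaryDensity (f '' (Z ∩ A i))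
    have hmem : ∀ i, ∀ y ∈ D i, f.symm y ∈ Z ∩ A i := by
      intro i y hy
      obtain ⟨x, hx, rfl⟩ := hDZ i hy
      simpa using hx
    refine ⟨⋃ i, f.symm '' D i, ?_, ?_, ?_⟩
    · refine iUnion_subset fun i => ?_
      rintro _ ⟨y, hy, rfl⟩
      exact (hmem i y hy).1
    · rw [← Cardinal.lift_le.{v}, Cardinal.lift_mul, hκ, Cardinal.lift_lift]
      exact mk_iUnion_image_le (fun _ => f.symm) D hcard
    · intro x hx
      obtain ⟨i, hi⟩ := h.exists_mem x
      refine mem_closure_iff.2 fun O hO hxO => ?_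
      obtain ⟨V, hV, hVO⟩ := h.exists_isOpen_target i hO
      obtain ⟨y, hyV, hyD⟩ :=
        mem_closure_iff.1 (hD i (mem_image_of_mem f ⟨hx, hi⟩)) V hV ((hVO x hi).2 hxO)
      exact ⟨f.symm y, (hVO _ (hmem i y hyD).2).1 (by simpa using hyV),
        mem_iUnion.2 ⟨i, y, hyD, rfl⟩⟩
  have := Cardinal.lift_le.{v}.2 hle
  rwa [Cardinal.lift_mul, hκ, Cardinal.lift_lift] at this

theorem lift_hereditaryDensity_le [T2Space X] [T2Space Y] [Countable ι]
    (h : PiecewiseHomeo f A) : Cardinal.lift.{v} (hereditaryDensity X) ≤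
      Cardinal.lift.{u} (hereditaryDensity Y) :=
  h.le_of_forall_le_mk_mul (fun _ => Cardinal.aleph0_le_lift.2 (aleph0_le_hereditaryDensity Y))
    lift_hereditaryDensity_le_mul

/-! ### Analytic, σ-compact and σ-Polish spaces -/

theorem isAnalyticSpace [Countable ι] (h : PiecewiseHomeo f A) (hY : IsAnalyticSpace Y) :
    IsAnalyticSpace X := by
  obtain ⟨P, _, _, g, hg, hsurj⟩ := hY
  have : ∀ i, PolishSpace (g ⁻¹' (f '' A i)) := fun i =>
    ((h.isClosed_image i).preimage hg).polishSpace
  refine ⟨Σ i, g ⁻¹' (f '' A i), inferInstance, inferInstance, fun p => f.symm (g p.2), ?_, ?_⟩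
  · refine continuous_sigma fun i => ?_
    exact (h.continuousOn_symm i).comp_continuous (hg.comp continuous_subtype_val) fun p => p.2
  · intro x
    obtain ⟨i, hi⟩ := h.exists_mem x
    obtain ⟨p, hp⟩ := hsurj (f x)
    exact ⟨⟨i, p, by rw [mem_preimage, hp]; exact mem_image_of_mem f hi⟩, by simp [hp]⟩

theorem sigmaCompactSpace [Countable ι] (h : PiecewiseHomeo f A) (hY : SigmaCompactSpace Y) :
    SigmaCompactSpace X := by
  have hcover : ⋃ p : ι × ℕ, f.symm '' (f '' A p.1 ∩ compactCovering Y p.2) = univ := by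
    refine eq_univ_of_forall fun x => ?_
    obtain ⟨i, hi⟩ := h.exists_mem x
    obtain ⟨n, hn⟩ := exists_mem_compactCovering (f x)
    exact mem_iUnion.2 ⟨(i, n), f x, ⟨mem_image_of_mem f hi, hn⟩, by simp⟩
  rw [← isSigmaCompact_univ_iff, ← hcover]
  refine isSigmaCompact_iUnion_of_isCompact _ fun p => ?_
  exact ((isCompact_compactCovering Y p.2).inter_left (h.isClosed_image p.1)).image_of_continuousOn
    ((h.continuousOn_symm p.1).mono inter_subset_left)

theorem isSigmaPolish [Countable ι] [Nonempty ι] (h : PiecewiseHomeo f A) (hY : IsSigmaPolish Y) :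
    IsSigmaPolish X := by
  obtain ⟨F, hFc, hFp, hF⟩ := hY
  obtain ⟨e, he⟩ := exists_surjective_nat (ι × ℕ)
  let B : ι × ℕ → Set X := fun p => A p.1 ∩ f ⁻¹' F p.2
  have hBc : ∀ p, IsClosed (B p) := fun p =>
    (h.continuousOn p.1).preimage_isClosed_of_isClosed (h.isClosed p.1) (hFc p.2)
  have hBp : ∀ p, PolishSpace (B p) := by
    intro p
    have := hFp p.2
    let φ : B p → F p.2 := fun x => ⟨f x, x.2.2⟩
    have hφ : Continuous φ := Continuous.subtype_mk
      ((h.continuousOn p.1).comp_continuous continuous_subtype_val fun x => x.2.1) _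
    have hinj : Function.Injective φ := fun x y hxy =>
      Subtype.ext (f.injective (congrArg Subtype.val hxy))
    refine (Topology.IsClosedEmbedding.of_continuous_injective_isClosedMap hφ hinj
      fun S hS => ?_).polishSpace
    have hSX : IsClosed ((↑) '' S : Set X) := (hBc p).isClosedMap_subtype_val S hS
    have hcl : IsClosed (f '' A p.1 ∩ f.symm ⁻¹' ((↑) '' S : Set X)) :=
      (h.continuousOn_symm p.1).preimage_isClosed_of_isClosed (h.isClosed_image p.1) hSX
    convert hcl.preimage continuous_subtype_val using 1
    ext ⟨y, hy⟩
    constructor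
    · rintro ⟨x, hx, hxy⟩
      have hxy' : f x = y := congrArg Subtype.val hxy
      subst hxy'
      exact ⟨mem_image_of_mem f x.2.1, x, hx, by simp⟩
    · rintro ⟨-, x, hx, hxy⟩
      exact ⟨x, hx, Subtype.ext (by simp [φ, hxy])⟩
  refine ⟨B ∘ e, fun n => hBc _, fun n => hBp _, eq_univ_of_forall fun x => ?_⟩
  obtain ⟨i, hi⟩ := h.exists_mem x
  obtain ⟨n, hn⟩ := mem_iUnion.1 (hF ▸ mem_univ (f x))
  obtain ⟨k, hk⟩ := he (i, n)
  exact mem_iUnion.2 ⟨k, by simpa [hk, B] using ⟨hi, hn⟩⟩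

end PiecewiseHomeo

/-! ### Covering dimension -/

/-- Every finite family of open sets covering `F` has an open shrinking that still covers `F` and
has order at most `n` at the points of `F`. -/
def CoveringDimLEOn {X : Type u} [TopologicalSpace X] (F : Set X) (n : ℕ) : Prop :=
  ∀ (k : ℕ) (U : Fin k → Set X), (∀ j, IsOpen (U j)) → F ⊆ ⋃ j, U j →
    ∃ V : Fin k → Set X, (∀ j, IsOpen (V j)) ∧ (∀ j, V j ⊆ U j) ∧ F ⊆ ⋃ j, V j ∧
      ∀ x ∈ F, {j | x ∈ V j}.encard ≤ n + 1

section CoveringDimension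

variable {X : Type u} [TopologicalSpace X] {n : ℕ}

theorem coveringDimLEOn_univ_iff : CoveringDimLEOn (univ : Set X) n ↔ CoveringDimLE X n := by
  constructor
  · intro h C hfin hCo hCU
    obtain ⟨k, U, -, rfl⟩ := hfin.fin_param
    obtain ⟨V, hVo, hVU, hV, hord⟩ :=
      h k U (forall_mem_range.1 hCo) (by rw [← sUnion_range, hCU])
    refine ⟨range V, finite_range V, forall_mem_range.2 hVo, ?_, ?_, fun x => ?_⟩
    · rw [sUnion_range]
      exact univ_subset_iff.1 hV
    · exact forall_mem_range.2 fun j => ⟨U j, mem_range_self j, hVU j⟩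
    · refine le_trans (encard_le_encard ?_) ((encard_image_le V _).trans (hord x (mem_univ x)))
      rintro _ ⟨⟨j, rfl⟩, hx⟩
      exact ⟨j, hx, rfl⟩
  · intro h k U hUo hU
    obtain ⟨R, -, hRo, hR, hRU, hord⟩ := h (range U) (finite_range U) (forall_mem_range.2 hUo)
      (by rw [sUnion_range]; exact univ_subset_iff.1 hU)
    have hRU' : ∀ V : R, ∃ j, (V : Set X) ⊆ U j := fun V => by
      obtain ⟨_, ⟨j, rfl⟩, hj⟩ := hRU V V.2
      exact ⟨j, hj⟩
    choose r hr using hRU'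
    refine ⟨fun j => ⋃ (V : R) (_ : r V = j), (V : Set X), ?_, ?_, ?_, fun x _ => ?_⟩
    · exact fun j => isOpen_iUnion fun V => isOpen_iUnion fun _ => hRo V V.2
    · refine fun j => iUnion₂_subset fun V hV => ?_
      rw [← hV]
      exact hr V
    · intro x _
      obtain ⟨V, hV, hxV⟩ := hR.ge (mem_univ x)
      exact mem_iUnion.2 ⟨r ⟨V, hV⟩, mem_iUnion₂.2 ⟨⟨V, hV⟩, rfl, hxV⟩⟩
    · have hle : {V : R | x ∈ (V : Set X)}.encard ≤ n + 1 := by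
        refine le_trans ?_ (hord x)
        rw [← Subtype.val_injective.encard_image]
        refine encard_le_encard ?_
        rintro _ ⟨V, hV, rfl⟩
        exact ⟨V.2, hV⟩
      refine le_trans (encard_le_encard ?_) ((encard_image_le r _).trans hle)
      intro j hj
      obtain ⟨V, hV, hxV⟩ := mem_iUnion₂.1 hj
      exact ⟨V, hxV, hV⟩

theorem CoveringDimLEOn.mono {F G : Set X} (h : CoveringDimLEOn G n) (hF : IsClosed F)
    (hFG : F ⊆ G) : CoveringDimLEOn F n := by
  intro k U hUo hU
  obtain ⟨V, hVo, hVU, hV, hord⟩ := h (k + 1) (Fin.cons Fᶜ U)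
    (Fin.cases hF.isOpen_compl hUo) (by
      intro x _
      by_cases hx : x ∈ F
      · obtain ⟨j, hj⟩ := mem_iUnion.1 (hU hx)
        exact mem_iUnion.2 ⟨j.succ, by simpa using hj⟩
      · exact mem_iUnion.2 ⟨0, by simpa using hx⟩)
  refine ⟨fun j => V j.succ, fun j => hVo _, fun j => by simpa using hVU j.succ, ?_, ?_⟩
  · intro x hx
    obtain ⟨j, hj⟩ := mem_iUnion.1 (hV (hFG hx))
    cases j using Fin.cases with
    | zero => exact absurd hx (by simpa using hVU 0 hj)
    | succ j => exact mem_iUnion.2 ⟨j, hj⟩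
  · intro x hx
    refine le_trans ?_ (hord x (hFG hx))
    rw [← (Fin.succ_injective k).encard_image]
    refine encard_le_encard ?_
    rintro _ ⟨j, hj, rfl⟩
    exact hj

/-- A finite family of closed sets of a normal space swells to a family of open sets without new
nonempty intersections. -/
theorem exists_open_swelling [NormalSpace X] {ι : Type*} [Finite ι] (K : ι → Set X)
    (hK : ∀ j, IsClosed (K j)) :
    ∃ G : ι → Set X, (∀ j, IsOpen (G j)) ∧ (∀ j, K j ⊆ G j) ∧
      ∀ S : Set ι, ⋂ j ∈ S, K j = ∅ → ⋂ j ∈ S, G j = ∅ := by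
  have hswell : ∀ S : Set ι, ∃ G : ι → Set X, (∀ j, IsOpen (G j)) ∧ (∀ j, K j ⊆ G j) ∧
      (⋂ j ∈ S, K j = ∅ → ⋂ j ∈ S, G j = ∅) := by
    intro S
    by_cases hS : ⋂ j ∈ S, K j = ∅
    · obtain ⟨v, hv, hvc, hvK⟩ := exists_iUnion_eq_closed_subset
        (u := fun j : S => (K j)ᶜ) (fun j => (hK j).isOpen_compl) (fun x => Set.toFinite _) (by
          rw [← compl_iInter, ← biInter_eq_iInter S fun j _ => K j, hS, compl_empty])
      classical
      refine ⟨fun j => if hj : j ∈ S then (v ⟨j, hj⟩)ᶜ else univ, fun j => ?_, fun j => ?_,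
        fun _ => ?_⟩
      · dsimp only
        split_ifs with hj
        exacts [(hvc _).isOpen_compl, isOpen_univ]
      · dsimp only
        split_ifs with hj
        exacts [subset_compl_comm.1 (hvK ⟨j, hj⟩), subset_univ _]
      · refine eq_empty_of_forall_notMem fun x hx => ?_
        obtain ⟨j, hj⟩ := mem_iUnion.1 (hv.ge (mem_univ x))
        have hxj := mem_iInter₂.1 hx j j.2
        simp only [dif_pos j.2] at hxj
        exact hxj hj
    · exact ⟨fun _ => univ, fun _ => isOpen_univ, fun _ => subset_univ _, fun h => absurd h hS⟩
  choose G hGo hKG hG using hswell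
  refine ⟨fun j => ⋂ S, G S j, fun j => isOpen_iInter_of_finite fun S => hGo S j,
    fun j => subset_iInter fun S => hKG S j, fun S hS => ?_⟩
  rw [← subset_empty_iff, ← hG S hS]
  exact iInter₂_mono fun j _ => iInter_subset _ S

/-- An open cover can be shrunk so that the closures have small order on a closed set of small
dimension. -/
theorem CoveringDimLEOn.exists_shrinking [NormalSpace X] {F : Set X} (h : CoveringDimLEOn F n)
    (hF : IsClosed F) {k : ℕ} (U : Fin k → Set X) (hUo : ∀ j, IsOpen (U j))
    (hU : ⋃ j, U j = univ) :
    ∃ V : Fin k → Set X, (∀ j, IsOpen (V j)) ∧ ⋃ j, V j = univ ∧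
      (∀ j, closure (V j) ⊆ U j) ∧ ∀ x ∈ F, {j | x ∈ closure (V j)}.encard ≤ n + 1 := by
  obtain ⟨W, hWo, hWU, hW, hord⟩ := h k U hUo (hU ▸ subset_univ F)
  obtain ⟨V, hV, hVo, hVW⟩ := exists_iUnion_eq_closure_subset
    (u := fun j => U j ∩ (W j ∪ Fᶜ))
    (fun j => (hUo j).inter ((hWo j).union hF.isOpen_compl)) (fun x => Set.toFinite _) (by
      refine eq_univ_of_forall fun x => ?_
      by_cases hx : x ∈ F
      · obtain ⟨j, hj⟩ := mem_iUnion.1 (hW hx)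
        exact mem_iUnion.2 ⟨j, hWU j hj, Or.inl hj⟩
      · obtain ⟨j, hj⟩ := mem_iUnion.1 (hU ▸ mem_univ x)
        exact mem_iUnion.2 ⟨j, hj, Or.inr hx⟩)
  refine ⟨V, hVo, hV, fun j => (hVW j).trans inter_subset_left, fun x hx => ?_⟩
  refine le_trans (encard_le_encard fun j hj => ?_) (hord x hx)
  exact (hVW j hj).2.resolve_right fun hxF => hxF hx

/-- The countable sum theorem for the covering dimension of normal spaces. -/
theorem coveringDimLEOn_univ_of_iUnion [NormalSpace X] (F : ℕ → Set X) (hFc : ∀ i, IsClosed (F i))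
    (hF : ⋃ i, F i = univ) (hdim : ∀ i, CoveringDimLEOn (F i) n) :
    CoveringDimLEOn (univ : Set X) n := by
  intro k U hUo hU
  let P := {V : Fin k → Set X // (∀ j, IsOpen (V j)) ∧ ⋃ j, V j = univ}
  choose next hnexto hnext hnextU hnextord using fun (i : ℕ) (V : P) =>
    (hdim i).exists_shrinking (hFc i) V.1 V.2.1 V.2.2
  let s : ℕ → P := fun i =>
    Nat.rec ⟨U, hUo, univ_subset_iff.1 hU⟩ (fun i V => ⟨next i V, hnexto i V, hnext i V⟩) i
  have hs : ∀ i j, closure ((s (i + 1)).1 j) ⊆ (s i).1 j := fun i j => hnextU i (s i) j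
  have hanti : ∀ j, Antitone fun i => (s i).1 j := fun j =>
    antitone_nat_of_succ_le fun i => subset_closure.trans (hs i j)
  let K : Fin k → Set X := fun j => ⋂ i, closure ((s (i + 1)).1 j)
  have hKs : ∀ i j, K j ⊆ (s i).1 j := fun i j => (iInter_subset _ i).trans (hs i j)
  have hKcover : ∀ x, ∃ j, x ∈ K j := by
    intro x
    choose c hc using fun i => mem_iUnion.1 ((s i).2.2.ge (mem_univ x))
    obtain ⟨j, hj⟩ := Finite.exists_infinite_fiber c
    refine ⟨j, mem_iInter.2 fun i => subset_closure ?_⟩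
    obtain ⟨m, hm, him⟩ := (infinite_coe_iff.1 hj).exists_gt (i + 1)
    have hmj : c m = j := hm
    exact hanti j him.le (hmj ▸ hc m)
  have hKord : ∀ x, {j | x ∈ K j}.encard ≤ n + 1 := by
    intro x
    obtain ⟨i, hi⟩ := mem_iUnion.1 (hF.ge (mem_univ x))
    refine le_trans (encard_le_encard fun j hj => ?_) (hnextord i (s i) x hi)
    exact mem_iInter.1 hj i
  obtain ⟨G, hGo, hKG, hG⟩ :=
    exists_open_swelling K fun j => isClosed_iInter fun i => isClosed_closure
  refine ⟨fun j => G j ∩ U j, fun j => (hGo j).inter (hUo j), fun j => inter_subset_right,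
    fun x _ => ?_, fun x _ => ?_⟩
  · obtain ⟨j, hj⟩ := hKcover x
    exact mem_iUnion.2 ⟨j, hKG j hj, hKs 0 j hj⟩
  · have hne : (⋂ j ∈ {j | x ∈ G j}, K j).Nonempty := by
      rw [nonempty_iff_ne_empty]
      intro hempty
      have hxG : x ∈ ⋂ j ∈ {j | x ∈ G j}, G j := mem_iInter₂.2 fun j hj => hj
      rw [hG _ hempty] at hxG
      exact hxG
    obtain ⟨y, hy⟩ := hne
    refine le_trans (encard_le_encard fun j hj => ?_) (hKord y)
    exact mem_iInter₂.1 hy j hj.1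

end CoveringDimension

namespace PiecewiseHomeo

variable {X : Type u} {Y : Type v} [TopologicalSpace X] [TopologicalSpace Y] {ι : Type}
  {f : X ≃ Y} {A : ι → Set X} {n : ℕ}

theorem coveringDimLEOn (h : PiecewiseHomeo f A) (i : ι) (hY : CoveringDimLEOn (f '' A i) n) :
    CoveringDimLEOn (A i) n := by
  intro k U hUo hU
  choose U' hU'o hU' using fun j => h.exists_isOpen_target i (hUo j)
  obtain ⟨V', hV'o, hVU', hV', hord⟩ := hY k U' hU'o (by
    rintro _ ⟨x, hx, rfl⟩
    obtain ⟨j, hj⟩ := mem_iUnion.1 (hU hx)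
    exact mem_iUnion.2 ⟨j, (hU' j x hx).2 hj⟩)
  choose V hVo hV using fun j => h.exists_isOpen_source i (hV'o j)
  refine ⟨fun j => V j ∩ U j, fun j => (hVo j).inter (hUo j), fun j => inter_subset_right,
    fun x hx => ?_, fun x hx => ?_⟩
  · obtain ⟨j, hj⟩ := mem_iUnion.1 (hV' (mem_image_of_mem f hx))
    exact mem_iUnion.2 ⟨j, (hV j x hx).2 hj, (hU' j x hx).1 (hVU' j hj)⟩
  · refine le_trans (encard_le_encard fun j hj => ?_) (hord (f x) (mem_image_of_mem f hx))
    exact (hV j x hx).1 hj.1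

theorem coveringDimLE [NormalSpace X] [Countable ι] [Nonempty ι] (h : PiecewiseHomeo f A)
    (hY : CoveringDimLE Y n) : CoveringDimLE X n := by
  obtain ⟨e, he⟩ := exists_surjective_nat ι
  rw [← coveringDimLEOn_univ_iff] at hY ⊢
  refine coveringDimLEOn_univ_of_iUnion (A ∘ e) (fun i => h.isClosed _)
    ((he.iUnion_comp A).trans h.cover) fun i => ?_
  exact h.coveringDimLEOn _ (hY.mono (h.isClosed_image _) (subset_univ _))

theorem coveringDim_eq [NormalSpace X] [NormalSpace Y] [Countable ι] [Nonempty ι]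
    (h : PiecewiseHomeo f A) : coveringDim X = coveringDim Y := by
  have hiff : ∀ n, CoveringDimLE X n ↔ CoveringDimLE Y n := fun n =>
    ⟨h.symm.coveringDimLE, h.coveringDimLE⟩
  simp only [coveringDim, hiff, f.isEmpty_congr]

end PiecewiseHomeo

theorem corollary3p9 (X : Type u) (Y : Type v) [TopologicalSpace X] [TopologicalSpace Y]
    (hX : PerfectlyParacompact X) (hY : PerfectlyParacompact Y) (h : WeaklyHomeomorphic X Y) :
    Cardinal.lift.{v} (networkWeight X) = Cardinal.lift.{u} (networkWeight Y) ∧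
    Cardinal.lift.{v} (hereditaryLindelofNumber X) =
      Cardinal.lift.{u} (hereditaryLindelofNumber Y) ∧
    Cardinal.lift.{v} (hereditaryDensity X) = Cardinal.lift.{u} (hereditaryDensity Y) ∧
    coveringDim X = coveringDim Y ∧
    (IsAnalyticSpace X ↔ IsAnalyticSpace Y) ∧
    (SigmaCompactSpace X ↔ SigmaCompactSpace Y) ∧
    (IsSigmaPolish X ↔ IsSigmaPolish Y) := by
  have := hX.t2
  have := hX.paracompact
  have := hY.t2
  have := hY.paracompact
  obtain ⟨f, A, hA⟩ := h.exists_piecewiseHomeo hX hY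
  exact ⟨hA.lift_networkWeight_le.antisymm hA.symm.lift_networkWeight_le,
    hA.lift_hereditaryLindelofNumber_le.antisymm hA.symm.lift_hereditaryLindelofNumber_le,
    hA.lift_hereditaryDensity_le.antisymm hA.symm.lift_hereditaryDensity_le,
    hA.coveringDim_eq,
    ⟨hA.symm.isAnalyticSpace, hA.isAnalyticSpace⟩,
    ⟨hA.symm.sigmaCompactSpace, hA.sigmaCompactSpace⟩,
    ⟨hA.symm.isSigmaPolish, hA.isSigmaPolish⟩⟩
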